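/- Consider a game with players $1,\dots,N$. Player $i$ chooses $x_i$ in a nonempty set $K_i\subseteq\mathbb R^n$ and has the cost $f_i(x_i,\bar x)$, where $\bar x=\sum_{j=1}^N x_j$ is the aggregate decision. Put $K=\prod_{i=1}^N K_i$, $\bar K=\sum_{i=1}^N K_i$ (Minkowski sum) and $\bar x_{-i}=\sum_{j\ne i}x_j$, so that, given the other players' decisions, player $i$ minimizes $z\mapsto f_i(z,z+\bar x_{-i})$ over $z\in K_i$. A point $x^*\in K$ is a Nash equilibrium if, for every $i$, $f_i(x_i^*,x_i^*+\bar x^*_{-i})\le f_i(z,z+\bar x^*_{-i})$ for all $z\in K_i$. Suppose that 1. for every $i$, the set $K_i$ is compact and convex, the function $f_i(x_i,y)$ is continuously differentiable in $(x_i,y)$ on some open set containing $K_i\times\bar K$, and, for every $x\in K$, the function $z\mapsto f_i(z,z+\bar x_{-i})$ is convex on $K_i$; 2. the map $\phi=(\phi_1,\dots,\phi_N):K\to\mathbb R^{nN}$, where $\phi_i(x)$ is the gradient at $z=x_i$ of $z\mapsto f_i(z,z+\bar x_{-i})$, is strictly monotone on $K$, that is, $(\phi(x)-\phi(x'))^T(x-x')>0$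 for all $x,x'\in K$ with $x\neq x'$. Then the game has a unique Nash equilibrium. Moreover, the variational inequality $\mathrm{VI}(K,\phi)$, which asks for $x^*\in K$ such that $(x-x^*)^T\phi(x^*)\ge 0$ for all $x\in K$, has a unique solution, and a point is a Nash equilibrium if and only if it solves $\mathrm{VI}(K,\phi)$. -/

import Mathlib

open scoped Pointwise

/-- The data of an aggregative game with `N` players deciding in `ℝⁿ`: the strategy sets `K i` and
the cost functions `f i (x_i, x̄)`. Only the behaviour of `f i` near `K i × (∑ j, K j)` matters. -/
structure AggregativeGame (n N : ℕ) where
  K : Fin N → Set (EuclideanSpace ℝ (Fin n))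
  f : Fin N → EuclideanSpace ℝ (Fin n) → EuclideanSpace ℝ (Fin n) → ℝ

namespace AggregativeGame

variable {n N : ℕ}

/-- The joint strategy set `K = ∏ i, K i`. -/
def jointSet (G : AggregativeGame n N) : Set (Fin N → EuclideanSpace ℝ (Fin n)) :=
  Set.univ.pi G.K

/-- The Minkowski sum `K̄ = ∑ i, K i`. -/
def aggregateSet (G : AggregativeGame n N) : Set (EuclideanSpace ℝ (Fin n)) :=
  ∑ i, G.K i

/-- The aggregate `x̄_{-i} = ∑ j ≠ i, x j` of the decisions of all players other than `i`. -/
def aggregateOthers (x : Fin N → EuclideanSpace ℝ (Fin n)) (i : Fin N) :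
    EuclideanSpace ℝ (Fin n) :=
  ∑ j ∈ Finset.univ.erase i, x j

/-- The cost `z ↦ f i (z, z + x̄_{-i})` of player `i` as a function of its own decision, when the
other players play according to `x`. -/
def ownCost (G : AggregativeGame n N) (i : Fin N) (x : Fin N → EuclideanSpace ℝ (Fin n)) :
    EuclideanSpace ℝ (Fin n) → ℝ :=
  fun z => G.f i z (z + aggregateOthers x i)

/-- The map `φ`, whose `i`-th block is the gradient of player `i`'s cost in its own decision. -/
noncomputable def phi (G : AggregativeGame n N) (x : Fin N → EuclideanSpace ℝ (Fin n)) :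
    Fin N → EuclideanSpace ℝ (Fin n) :=
  fun i => gradient (G.ownCost i x) (x i)

/-- The strategy sets are nonempty, compact and convex, each `f i` is `C¹` on an open set
containing `K i × K̄`, and each player's cost is convex in the player's own decision. -/
structure IsConvexSmooth (G : AggregativeGame n N) : Prop where
  nonempty : ∀ i, (G.K i).Nonempty
  isCompact : ∀ i, IsCompact (G.K i)
  convex : ∀ i, Convex ℝ (G.K i)
  contDiffOn : ∀ i, ∃ U : Set (EuclideanSpace ℝ (Fin n) × EuclideanSpace ℝ (Fin n)),
    IsOpen U ∧ G.K i ×ˢ G.aggregateSet ⊆ U ∧ ContDiffOn ℝ 1 (Function.uncurry (G.f i)) U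
  convexOn : ∀ i, ∀ x ∈ G.jointSet, ConvexOn ℝ (G.K i) (G.ownCost i x)

/-- `φ` is strictly monotone over `K`; the inner product of `ℝ^{nN}` is written blockwise. -/
def IsStrictlyMonotone (G : AggregativeGame n N) : Prop :=
  ∀ x ∈ G.jointSet, ∀ y ∈ G.jointSet, x ≠ y →
    0 < ∑ i, inner ℝ (G.phi x i - G.phi y i) (x i - y i)

/-- `x` is a Nash equilibrium: no player can lower its cost by deviating alone. -/
def IsNashEquilibrium (G : AggregativeGame n N) (x : Fin N → EuclideanSpace ℝ (Fin n)) : Prop :=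
  x ∈ G.jointSet ∧ ∀ i, IsMinOn (G.ownCost i x) (G.K i) (x i)

/-- `x` solves the variational inequality `VI(K, φ)`. -/
def IsVISolution (G : AggregativeGame n N) (x : Fin N → EuclideanSpace ℝ (Fin n)) : Prop :=
  x ∈ G.jointSet ∧ ∀ y ∈ G.jointSet, 0 ≤ ∑ i, inner ℝ (y i - x i) (G.phi x i)

end AggregativeGame

/-!
A player's cost is convex and differentiable in the player's own decision, so `x i` is optimal
exactly if `⟪z - x i, φ x i⟫ ≥ 0` for every `z ∈ K i`, and on a product set these inequalities are
equivalent to their sum: Nash equilibria are the solutions of `VI(K, φ)`. Two solutions coincide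
because adding their inequalities contradicts strict monotonicity.

For existence, look first for `x` with `⟪y - x, φ y⟫ ≥ 0` for all `y ∈ K` (Minty's inequalities),
which are affine in `x`. By the minimax theorem and compactness such a system is solvable on `K` if
every convex combination of its members is, and monotonicity lets the corresponding convex
combination of the points `y` solve it. Letting `y` tend to `x` along segments turns Minty's
inequalities into `VI(K, φ)`.
-/

open Set Topology

section ConvexSystems

variable {V ι : Type*} [AddCommGroup V] [Module ℝ V] [TopologicalSpace V]
  [IsTopologicalAddGroup V] [ContinuousSMul ℝ V] {K : Set V} {T : ι → V → ℝ}

theorem exists_forall_nonpos_of_forall_stdSimplex [Fintype ι] (hne : K.Nonempty)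
    (hc : IsCompact K) (hconv : ∀ i, ConvexOn ℝ K (T i))
    (hlsc : ∀ i, LowerSemicontinuousOn (T i) K)
    (hT : ∀ w ∈ stdSimplex ℝ ι, ∃ x ∈ K, ∑ i, w i * T i x ≤ 0) :
    ∃ x ∈ K, ∀ i, T i x ≤ 0 := by
  classical
  rcases isEmpty_or_nonempty ι with hι | ⟨⟨i₀⟩⟩
  · exact hne.imp fun x hx => ⟨hx, isEmptyElim⟩
  let L : V → (ι → ℝ) →ₗ[ℝ] ℝ := fun x => ∑ i, T i x • LinearMap.proj i
  have hL : ∀ x w, L x w = ∑ i, w i * T i x := fun x w => by simp [L, mul_comm]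
  have hconvL : ∀ w ∈ stdSimplex ℝ ι, ConvexOn ℝ K fun x => L x w := fun w hw => by
    have h : ConvexOn ℝ K (∑ i, w i • T i) :=
      Finset.sum_induction _ (ConvexOn ℝ K) (fun _ _ => ConvexOn.add)
        (convexOn_const 0 (hconv i₀).1) fun i _ => (hconv i).smul (hw.1 i)
    exact h.congr fun x _ => by simp [hL]
  have hlscL : ∀ w ∈ stdSimplex ℝ ι, LowerSemicontinuousOn (fun x => L x w) K := fun w hw => by
    simp only [hL]
    exact lowerSemicontinuousOn_sum fun i _ =>
      (continuous_const_mul (w i)).comp_lowerSemicontinuousOn (hlsc i)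
        (monotone_mul_left_of_nonneg (hw.1 i))
  obtain ⟨a, ha, b, hb, hab⟩ := Sion.exists_isSaddlePointOn hne (hconv i₀).1 hc hlscL
    (fun w hw => (hconvL w hw).quasiconvexOn) (convex_stdSimplex ℝ ι)
    ⟨_, single_mem_stdSimplex ℝ i₀⟩ (isCompact_stdSimplex ℝ ι)
    (fun x _ => (L x).continuous_of_finiteDimensional.upperSemicontinuous.upperSemicontinuousOn _)
    (fun x _ => ((L x).concaveOn (convex_stdSimplex ℝ ι)).quasiconcaveOn)
  obtain ⟨x, hx, hxb⟩ := hT b hb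
  refine ⟨a, ha, fun i => ?_⟩
  calc T i a = L a (Pi.single i 1) := by simp [hL, Pi.single_apply]
    _ ≤ L x b := hab x hx _ (single_mem_stdSimplex ℝ i)
    _ ≤ 0 := by rwa [hL]

/-- **Fan's theorem** on systems of convex inequalities. -/
theorem exists_forall_nonpos_of_forall_finset_stdSimplex (hne : K.Nonempty) (hc : IsCompact K)
    (hconv : ∀ i, ConvexOn ℝ K (T i)) (hlsc : ∀ i, LowerSemicontinuousOn (T i) K)
    (hT : ∀ s : Finset ι, ∀ w ∈ stdSimplex ℝ s, ∃ x ∈ K, ∑ i, w i * T i x ≤ 0) :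
    ∃ x ∈ K, ∀ i, T i x ≤ 0 := by
  choose C hC hKC using fun i => lowerSemicontinuousOn_iff_preimage_Iic.1 (hlsc i) 0
  have hmem : ∀ {x}, x ∈ K → ∀ i, x ∈ C i ↔ T i x ≤ 0 := fun {x} hx i => by
    simpa [hx] using (Set.ext_iff.1 (hKC i) x).symm
  obtain ⟨x, hx, hxC⟩ := hc.inter_iInter_nonempty C hC fun s => by
    obtain ⟨x, hx, h⟩ := exists_forall_nonpos_of_forall_stdSimplex hne hc
      (fun i : s => hconv i) (fun i => hlsc i) (hT s)
    exact ⟨x, hx, mem_iInter₂.2 fun i hi => (hmem hx i).2 (h ⟨i, hi⟩)⟩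
  exact ⟨x, hx, fun i => (hmem hx i).1 (mem_iInter.1 hxC i)⟩

end ConvexSystems

namespace VariationalInequality

variable {V : Type*} [AddCommGroup V] [Module ℝ V] [TopologicalSpace V]

/-- Monotone operators from a set `K` to the dual space; `Φ` is a total function, but only its
values on `K` matter. -/
def IsMonotone (Φ : V → StrongDual ℝ V) (K : Set V) : Prop :=
  ∀ x ∈ K, ∀ y ∈ K, 0 ≤ (Φ x - Φ y) (x - y)

/-- Strictly monotone operators from a set `K` to the dual space. -/
def IsStrictlyMonotone (Φ : V → StrongDual ℝ V) (K : Set V) : Prop :=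
  ∀ x ∈ K, ∀ y ∈ K, x ≠ y → 0 < (Φ x - Φ y) (x - y)

/-- Hemicontinuous operators: continuity along the segments of `K`. Testing it at the starting
point of a segment and against the direction of the segment is enough for Minty's lemma. -/
def IsHemicontinuous (Φ : V → StrongDual ℝ V) (K : Set V) : Prop :=
  ∀ x ∈ K, ∀ y ∈ K,
    ContinuousWithinAt (fun t : ℝ => Φ (AffineMap.lineMap x y t) (y - x)) (Icc 0 1) 0

/-- Solutions of the (Stampacchia) variational inequality `VI(K, Φ)`. -/
def IsSolution (Φ : V → StrongDual ℝ V) (K : Set V) (x : V) : Prop :=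
  x ∈ K ∧ ∀ y ∈ K, 0 ≤ Φ x (y - x)

/-- Solutions of the Minty variational inequality, in which the operator is evaluated at the test
point `y` instead of the solution; the inequalities are then affine in `x`. -/
def IsMintySolution (Φ : V → StrongDual ℝ V) (K : Set V) (x : V) : Prop :=
  x ∈ K ∧ ∀ y ∈ K, 0 ≤ Φ y (y - x)

variable {Φ : V → StrongDual ℝ V} {K : Set V}

theorem IsStrictlyMonotone.isMonotone (hΦ : IsStrictlyMonotone Φ K) : IsMonotone Φ K := by
  intro x hx y hy
  rcases eq_or_ne x y with rfl | hne
  · simp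
  · exact (hΦ x hx y hy hne).le

theorem IsStrictlyMonotone.eq_of_isSolution (hΦ : IsStrictlyMonotone Φ K) {x y : V}
    (hx : IsSolution Φ K x) (hy : IsSolution Φ K y) : x = y := by
  by_contra hne
  have hpos : 0 < (Φ x - Φ y) (x - y) := hΦ x hx.1 y hy.1 hne
  have hsum : (Φ x - Φ y) (x - y) = -(Φ x (y - x) + Φ y (x - y)) := by
    simp only [sub_apply, map_sub]
    ring
  linarith [hx.2 y hy.1, hy.2 x hx.1]

theorem isHemicontinuous_of_continuousOn [IsTopologicalAddGroup V] [ContinuousSMul ℝ V]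
    (hK : Convex ℝ K) (hΦ : ∀ v, ContinuousOn (fun x => Φ x v) K) : IsHemicontinuous Φ K := by
  intro x hx y hy
  have hmaps : MapsTo (AffineMap.lineMap x y) (Icc (0 : ℝ) 1) K := fun t ht =>
    hK.lineMap_mem hx hy ht
  exact (hΦ (y - x)).comp AffineMap.lineMap_continuous.continuousOn hmaps 0
    (left_mem_Icc.2 zero_le_one)

theorem IsMonotone.sum_mul_apply_sub_nonpos (hΦ : IsMonotone Φ K) {ι : Type*} [Fintype ι]
    {w : ι → ℝ} (hw : w ∈ stdSimplex ℝ ι) {y : ι → V} (hy : ∀ i, y i ∈ K) :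
    ∑ i, w i * Φ (y i) (∑ j, w j • y j - y i) ≤ 0 := by
  let S : ι → ι → ℝ := fun i j => w i * w j * Φ (y i) (y j - y i)
  have hS : ∑ i, w i * Φ (y i) (∑ j, w j • y j - y i) = ∑ i, ∑ j, S i j := by
    refine Finset.sum_congr rfl fun i _ => ?_
    have hdiff : ∑ j, w j • y j - y i = ∑ j, w j • (y j - y i) := by
      simp only [smul_sub, Finset.sum_sub_distrib, ← Finset.sum_smul, hw.2, one_smul]
    simp only [S, hdiff, map_sum, map_smul, smul_eq_mul, Finset.mul_sum, mul_assoc]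
  have hsymm : ∀ i j, S i j + S j i ≤ 0 := fun i j => by
    have hij : S i j + S j i = -(w i * w j * (Φ (y i) - Φ (y j)) (y i - y j)) := by
      simp only [S, sub_apply, map_sub]
      ring
    rw [hij, neg_nonpos]
    exact mul_nonneg (mul_nonneg (hw.1 i) (hw.1 j)) (hΦ _ (hy i) _ (hy j))
  have htwice : ∑ i, ∑ j, S i j + ∑ i, ∑ j, S i j ≤ 0 :=
    calc ∑ i, ∑ j, S i j + ∑ i, ∑ j, S i j = ∑ i, ∑ j, S i j + ∑ i, ∑ j, S j i :=
          congrArg (_ + ·) Finset.sum_comm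
      _ = ∑ i, ∑ j, (S i j + S j i) := by simp only [Finset.sum_add_distrib]
      _ ≤ 0 := Finset.sum_nonpos fun i _ => Finset.sum_nonpos fun j _ => hsymm i j
  linarith

theorem IsMonotone.exists_isMintySolution [IsTopologicalAddGroup V] [ContinuousSMul ℝ V]
    (hΦ : IsMonotone Φ K) (hne : K.Nonempty) (hc : IsCompact K) (hK : Convex ℝ K) :
    ∃ x, IsMintySolution Φ K x := by
  let T : K → V → ℝ := fun y x => Φ y (x - y)
  have hconv : ∀ y, ConvexOn ℝ K (T y) := fun y =>
    (((Φ y).toLinearMap.convexOn hK).sub (concaveOn_const (Φ y y) hK)).congr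
      fun x _ => (map_sub (Φ y) x y).symm
  have hcont : ∀ y, Continuous (T y) := fun y => by fun_prop
  obtain ⟨x, hx, hxΦ⟩ := exists_forall_nonpos_of_forall_finset_stdSimplex hne hc hconv
    (fun y => (hcont y).lowerSemicontinuous.lowerSemicontinuousOn K) fun s w hw =>
      ⟨∑ j, w j • (j : V), hK.sum_mem (fun j _ => hw.1 j) hw.2 fun j _ => j.1.2,
        hΦ.sum_mul_apply_sub_nonpos hw fun j => j.1.2⟩
  refine ⟨x, hx, fun y hy => ?_⟩
  rw [← neg_sub, map_neg, neg_nonneg]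
  exact hxΦ ⟨y, hy⟩

/-- **Minty's lemma**. -/
theorem IsMintySolution.isSolution (hK : Convex ℝ K) (hΦ : IsHemicontinuous Φ K) {x : V}
    (hx : IsMintySolution Φ K x) : IsSolution Φ K x := by
  refine ⟨hx.1, fun y hy => ?_⟩
  have hlim : Filter.Tendsto (fun t : ℝ => Φ (AffineMap.lineMap x y t) (y - x)) (𝓝[>] 0)
      (𝓝 (Φ x (y - x))) := by
    have h := (hΦ x hx.1 y hy).tendsto.mono_left (nhdsWithin_mono 0 Ioc_subset_Icc_self)
    simpa only [AffineMap.lineMap_apply_zero, nhdsWithin_Ioc_eq_nhdsGT zero_lt_one] using h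
  refine ge_of_tendsto hlim ?_
  filter_upwards [Ioc_mem_nhdsGT zero_lt_one] with t ht
  have hminty := hx.2 _ (hK.lineMap_mem hx.1 hy (Ioc_subset_Icc_self ht))
  have hstep : AffineMap.lineMap x y t - x = t • (y - x) := by
    simp [AffineMap.lineMap_apply]
  rw [hstep, map_smul, smul_eq_mul] at hminty
  exact nonneg_of_mul_nonneg_right hminty ht.1

/-- The **Hartman–Stampacchia–Browder theorem**. -/
theorem IsMonotone.exists_isSolution [IsTopologicalAddGroup V] [ContinuousSMul ℝ V]
    (hmono : IsMonotone Φ K) (hcont : IsHemicontinuous Φ K) (hne : K.Nonempty)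
    (hc : IsCompact K) (hK : Convex ℝ K) : ∃ x, IsSolution Φ K x :=
  (hmono.exists_isMintySolution hne hc hK).imp fun _ hx => hx.isSolution hK hcont

theorem IsStrictlyMonotone.existsUnique_isSolution [IsTopologicalAddGroup V] [ContinuousSMul ℝ V]
    (hmono : IsStrictlyMonotone Φ K) (hcont : IsHemicontinuous Φ K) (hne : K.Nonempty)
    (hc : IsCompact K) (hK : Convex ℝ K) : ∃! x, IsSolution Φ K x :=
  existsUnique_of_exists_of_unique (hmono.isMonotone.exists_isSolution hcont hne hc hK)
    fun _ _ => hmono.eq_of_isSolution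

end VariationalInequality

theorem isMinOn_iff_forall_hasFDerivWithinAt_nonneg {E : Type*} [NormedAddCommGroup E]
    [NormedSpace ℝ E] {K : Set E} {g : E → ℝ} {g' : StrongDual ℝ E} {x : E}
    (hg : ConvexOn ℝ K g) (hx : x ∈ K) (hg' : HasFDerivWithinAt g g' K x) :
    IsMinOn g K x ↔ ∀ z ∈ K, 0 ≤ g' (z - x) := by
  refine ⟨fun hmin z hz => hmin.localize.hasFDerivWithinAt_nonneg hg'
    (sub_mem_posTangentConeAt_of_segment_subset (hg.1.segment_subset hx hz)), fun h z hz => ?_⟩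
  let γ : ℝ →ᵃ[ℝ] E := AffineMap.lineMap x z
  have hderiv : HasDerivWithinAt (g ∘ γ) (g' (z - x)) (γ ⁻¹' K) 0 :=
    HasFDerivWithinAt.comp_hasDerivWithinAt (t := K) (0 : ℝ) (by simpa [γ] using hg')
      AffineMap.hasDerivAt_lineMap.hasDerivWithinAt (mapsTo_preimage γ K)
  have hslope : g' (z - x) ≤ slope (g ∘ γ) 0 1 :=
    (hg.comp_affineMap γ).le_slope_of_hasDerivWithinAt (by simpa [γ] using hx)
      (by simpa [γ] using hz) zero_lt_one hderiv
  have hdiff : slope (g ∘ γ) 0 1 = g z - g x := by simp [γ, slope_def_field]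
  exact sub_nonneg.1 (hdiff ▸ (h z hz).trans hslope)

theorem forall_mem_pi_sum_nonneg_iff {ι M : Type*} [Fintype ι] [AddCommMonoid M] [PartialOrder M]
    [IsOrderedAddMonoid M] {α : ι → Type*} {K : ∀ i, Set (α i)} {g : ∀ i, α i → M} {x : ∀ i, α i}
    (hx : x ∈ univ.pi K) (hg : ∀ i, g i (x i) = 0) :
    (∀ y ∈ univ.pi K, 0 ≤ ∑ i, g i (y i)) ↔ ∀ i, ∀ z ∈ K i, 0 ≤ g i z := by
  classical
  refine ⟨fun h i z hz => ?_, fun h y hy => Finset.sum_nonneg fun i _ => h i _ (hy i (mem_univ i))⟩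
  have hsum : ∑ j, g j (Function.update x i z j) = g i z := by
    rw [Finset.sum_eq_single i (fun j _ hj => by simp [hj, hg]) (by simp), Function.update_self]
  exact hsum ▸ h _ (update_mem_pi_iff_of_mem hx |>.2 fun _ => hz)

namespace AggregativeGame

variable {n N : ℕ} {G : AggregativeGame n N} {x y : Fin N → EuclideanSpace ℝ (Fin n)}

theorem mk_add_aggregateOthers_mem (hx : x ∈ G.jointSet) (i : Fin N) :
    (x i, x i + aggregateOthers x i) ∈ G.K i ×ˢ G.aggregateSet := by
  have hsum : x i + aggregateOthers x i = ∑ j, x j :=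
    Finset.add_sum_erase _ _ (Finset.mem_univ i)
  rw [hsum]
  exact ⟨hx i (mem_univ i), finsetSum_mem_finsetSum _ _ _ fun j _ => hx j (mem_univ j)⟩

namespace IsConvexSmooth

theorem hasFDerivAt_ownCost (hG : G.IsConvexSmooth) (hx : x ∈ G.jointSet) (i : Fin N) :
    HasFDerivAt (G.ownCost i x)
      ((fderiv ℝ (Function.uncurry (G.f i)) (x i, x i + aggregateOthers x i)).comp
        ((ContinuousLinearMap.id ℝ _).prod (ContinuousLinearMap.id ℝ _))) (x i) := by
  obtain ⟨U, hU, hsub, hf⟩ := hG.contDiffOn i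
  have hd : DifferentiableAt ℝ (Function.uncurry (G.f i)) (x i, x i + aggregateOthers x i) :=
    (hf.contDiffAt (hU.mem_nhds (hsub (mk_add_aggregateOthers_mem hx i)))).differentiableAt
      one_ne_zero
  have hpair : HasFDerivAt (fun z => (z, z + aggregateOthers x i))
      ((ContinuousLinearMap.id ℝ _).prod (ContinuousLinearMap.id ℝ _)) (x i) :=
    (hasFDerivAt_id (x i)).prodMk ((hasFDerivAt_id (x i)).add_const _)
  exact hd.hasFDerivAt.comp (x i) hpair

theorem hasGradientAt_ownCost (hG : G.IsConvexSmooth) (hx : x ∈ G.jointSet) (i : Fin N) :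
    HasGradientAt (G.ownCost i x) (G.phi x i) (x i) :=
  (hG.hasFDerivAt_ownCost hx i).differentiableAt.hasGradientAt

theorem continuousOn_phi (hG : G.IsConvexSmooth) : ContinuousOn G.phi G.jointSet := by
  refine continuousOn_pi.2 fun i => ?_
  obtain ⟨U, hU, hsub, hf⟩ := hG.contDiffOn i
  have hpair : Continuous fun x : Fin N → EuclideanSpace ℝ (Fin n) =>
      (x i, x i + aggregateOthers x i) := by
    unfold aggregateOthers
    fun_prop
  have hfderiv := (hf.continuousOn_fderiv_of_isOpen hU le_rfl).comp hpair.continuousOn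
    fun x hx => hsub (mk_add_aggregateOthers_mem hx i)
  refine ((InnerProductSpace.toDual ℝ _).symm.continuous.comp_continuousOn
    (hfderiv.clm_comp (continuousOn_const
      (c := (ContinuousLinearMap.id ℝ _).prod (ContinuousLinearMap.id ℝ _))))).congr fun x hx => ?_
  rw [phi, gradient, (hG.hasFDerivAt_ownCost hx i).fderiv]
  rfl

end IsConvexSmooth

theorem isNashEquilibrium_iff_isVISolution (hG : G.IsConvexSmooth)
    (x : Fin N → EuclideanSpace ℝ (Fin n)) : G.IsNashEquilibrium x ↔ G.IsVISolution x := by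
  refine and_congr_right fun hx => ?_
  have hmin : ∀ i, IsMinOn (G.ownCost i x) (G.K i) (x i) ↔
      ∀ z ∈ G.K i, 0 ≤ inner ℝ (z - x i) (G.phi x i) := fun i => by
    simpa only [InnerProductSpace.toDual_apply_apply, real_inner_comm] using
      isMinOn_iff_forall_hasFDerivWithinAt_nonneg (hG.convexOn i x hx) (hx i (mem_univ i))
        (hG.hasGradientAt_ownCost hx i).hasFDerivAt.hasFDerivWithinAt
  simp only [hmin]
  exact (forall_mem_pi_sum_nonneg_iff hx fun i => by simp).symm

/-- The functional `v ↦ vᵀ φ(x)`: the map `φ` as an operator into the dual of the space of joint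
decisions, which carries the product norm and hence no inner product of its own. -/
noncomputable def phiFunctional (G : AggregativeGame n N)
    (x : Fin N → EuclideanSpace ℝ (Fin n)) : StrongDual ℝ (Fin N → EuclideanSpace ℝ (Fin n)) :=
  ∑ i, (innerSL ℝ (G.phi x i)).comp (ContinuousLinearMap.proj i)

theorem phiFunctional_apply (G : AggregativeGame n N) (x v : Fin N → EuclideanSpace ℝ (Fin n)) :
    G.phiFunctional x v = ∑ i, inner ℝ (v i) (G.phi x i) := by
  simp [phiFunctional, real_inner_comm]

theorem isVISolution_iff_phiFunctional :
    G.IsVISolution x ↔ VariationalInequality.IsSolution G.phiFunctional G.jointSet x := by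
  simp only [IsVISolution, VariationalInequality.IsSolution, phiFunctional_apply, Pi.sub_apply]

theorem isStrictlyMonotone_iff_phiFunctional :
    G.IsStrictlyMonotone ↔
      VariationalInequality.IsStrictlyMonotone G.phiFunctional G.jointSet := by
  have hinner : ∀ x y, (G.phiFunctional x - G.phiFunctional y) (x - y) =
      ∑ i, inner ℝ (G.phi x i - G.phi y i) (x i - y i) := fun x y => by
    simp only [sub_apply, phiFunctional_apply, Pi.sub_apply, ← Finset.sum_sub_distrib,
      ← inner_sub_right]
    exact Finset.sum_congr rfl fun i _ => real_inner_comm _ _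
  simp only [IsStrictlyMonotone, VariationalInequality.IsStrictlyMonotone, hinner]

theorem IsConvexSmooth.isHemicontinuous_phiFunctional (hG : G.IsConvexSmooth) :
    VariationalInequality.IsHemicontinuous G.phiFunctional G.jointSet := by
  refine VariationalInequality.isHemicontinuous_of_continuousOn
    (convex_pi fun i _ => hG.convex i) fun v => ?_
  simp only [phiFunctional_apply]
  exact continuousOn_finsetSum _ fun i _ =>
    continuousOn_const.inner (𝕜 := ℝ) (continuousOn_pi.1 hG.continuousOn_phi i)

theorem existsUnique_isVISolution (hG : G.IsConvexSmooth) (hφ : G.IsStrictlyMonotone) :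
    ∃! x, G.IsVISolution x := by
  simpa only [isVISolution_iff_phiFunctional] using
    (isStrictlyMonotone_iff_phiFunctional.1 hφ).existsUnique_isSolution
      hG.isHemicontinuous_phiFunctional (univ_pi_nonempty_iff.2 hG.nonempty)
      (isCompact_univ_pi hG.isCompact) (convex_pi fun i _ => hG.convex i)

end AggregativeGame

theorem mainTheorem4 {n N : ℕ} (G : AggregativeGame n N) (hG : G.IsConvexSmooth)
    (hφ : G.IsStrictlyMonotone) :
    (∃! x, G.IsNashEquilibrium x) ∧ (∃! x, G.IsVISolution x) ∧
      ∀ x, G.IsNashEquilibrium x ↔ G.IsVISolution x := by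
  have hiff := AggregativeGame.isNashEquilibrium_iff_isVISolution hG
  have hVI := AggregativeGame.existsUnique_isVISolution hG hφ
  refine ⟨?_, hVI, hiff⟩
  simpa only [hiff] using hVI
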